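/- Let $k$ be a perfect field of characteristic $p>0$ with algebraic closure $\overline{k}$, let $n<p$, and let $\mathcal{Y}\subset\mathbb{P}^n(\overline{k})$ be an irreducible projective curve defined over $k$ and contained in no hyperplane. Let $k(\mathcal{Y})\subset\overline{k}(\mathcal{Y})$ be its function fields over $k$ and over $\overline{k}$, and let $\tilde{\mathcal{Y}}$ be a nonsingular model of $\mathcal{Y}$, whose points $P$ are identified with the discrete valuation rings of $\overline{k}(\mathcal{Y})$ containing $\overline{k}$. Let $y_0,\dots,y_n\in k(\mathcal{Y})$ be coordinate functions of $\mathcal{Y}$, i.e. functions, not all zero, such that $(y_0:\cdots:y_n)$ is the inclusion of $\mathcal{Y}$ in $\mathbb{P}^n$. For $P\in\tilde{\mathcal{Y}}$ and a hyperplane $H:\sum_k a_kY_k=0$, let $$I(P,\mathcal{Y}\cap H)=v_P\Big(\sum_{k} a_k y_k\Big)-\min_{k} v_P(y_k)$$ be the intersection multiplicity of $\mathcal{Y}$ and $H$ at $P$. Let $r>0$ be an integer and let $u_0,\dots,u_n\in k(\mathcal{Y})$, not all zero, satisfy $$u_0^{p^r}y_0+u_1^{p^r}y_1+\cdots+u_n^{p^r}y_n=0.$$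 Then, for all but finitely many points $P\in\tilde{\mathcal{Y}}$, the functions $u_0,\dots,u_n$ are regular and not all zero at $P$, the hyperplane $$H^r_P:\ u_0(P)^{p^r}Y_0+u_1(P)^{p^r}Y_1+\cdots+u_n(P)^{p^r}Y_n=0$$ satisfies $I(P,\mathcal{Y}\cap H^r_P)\ge p^r$, and, for every separating element $\zeta$ of $k(\mathcal{Y})/k$, $$I(P,\mathcal{Y}\cap H^r_P)=p^r\iff \big(D^{(1)}_\zeta u_0\big)^{p^r}y_0+\big(D^{(1)}_\zeta u_1\big)^{p^r}y_1+\cdots+\big(D^{(1)}_\zeta u_n\big)^{p^r}y_n\neq 0.$$ Here $\zeta$ is separating if it is transcendental over $k$ and $k(\mathcal{Y})$ is separable algebraic over $k(\zeta)$, and $D^{(1)}_\zeta$ is the first Hasse derivative with respect to $\zeta$, i.e. the unique $k$-derivation of $k(\mathcal{Y})$ with $D^{(1)}_\zeta\zeta=1$. -/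

import Mathlib

open scoped LinearAlgebra.Projectivization

noncomputable section

/-! ### Separating elements and the first Hasse derivative -/

/-- `ζ` is a separating element of the field extension `E / F`: it is transcendental over `F` and
`E` is separable algebraic over `F(ζ)`. -/
structure IsSeparatingElement (F : Type*) {E : Type*} [Field F] [Field E] [Algebra F E]
    (ζ : E) : Prop where
  transcendental : Transcendental F ζ
  isSeparable : Algebra.IsSeparable (IntermediateField.adjoin F {ζ}) E

open scoped IntermediateField.algebraAdjoinAdjoin in
theorem IsSeparatingElement.existsUnique_derivation {F E : Type*} [Field F] [Field E]
    [Algebra F E] {ζ : E} (hζ : IsSeparatingElement F ζ) :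
    ∃! D : Derivation F E E, D ζ = 1 := by
  let _ : Algebra (Polynomial F) E := (Polynomial.aeval ζ).toAlgebra
  have hX : algebraMap (Polynomial F) E Polynomial.X = ζ := Polynomial.aeval_X ζ
  let g : Polynomial F →ₐ[F] Algebra.adjoin F {ζ} :=
    Polynomial.aeval ⟨ζ, Algebra.self_mem_adjoin_singleton F ζ⟩
  have hg : ∀ q, (g q : E) = Polynomial.aeval ζ q := fun q =>
    (Polynomial.aeval_algHom_apply (Algebra.adjoin F {ζ}).val
      (⟨ζ, Algebra.self_mem_adjoin_singleton F ζ⟩ : Algebra.adjoin F {ζ}) q).symm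
  let _ : Algebra (Polynomial F) (Algebra.adjoin F {ζ}) := g.toAlgebra
  have _ : IsScalarTower F (Polynomial F) E :=
    IsScalarTower.of_algebraMap_eq fun a => ((Polynomial.aeval ζ).commutes a).symm
  have _ : IsScalarTower (Polynomial F) (Algebra.adjoin F {ζ}) E :=
    IsScalarTower.of_algebraMap_eq fun a => (hg a).symm
  have hbij : Function.Bijective (algebraMap (Polynomial F) (Algebra.adjoin F {ζ})) := by
    constructor
    · intro a b hab
      have : Polynomial.aeval ζ a = Polynomial.aeval ζ b := by
        rw [← hg, ← hg]; exact congrArg _ hab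
      exact transcendental_iff_injective.mp hζ.transcendental this
    · rintro ⟨x, hx⟩
      have hx' := hx
      rw [Algebra.adjoin_singleton_eq_range_aeval] at hx'
      obtain ⟨q, hq⟩ := hx'
      exact ⟨q, Subtype.ext ((hg q).trans hq)⟩
  have _ : Algebra.FormallyEtale (Polynomial F) (Algebra.adjoin F {ζ}) :=
    .of_equiv (AlgEquiv.ofBijective (Algebra.ofId (Polynomial F) _) hbij)
  have _ : Algebra.FormallyEtale (Algebra.adjoin F {ζ}) (IntermediateField.adjoin F {ζ}) :=
    .of_isLocalization (nonZeroDivisors _)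
  have _ : Algebra.IsSeparable (IntermediateField.adjoin F {ζ}) E := hζ.isSeparable
  have _ : Algebra.FormallyEtale (IntermediateField.adjoin F {ζ}) E := .of_isSeparable _ _
  have _ : Algebra.FormallyEtale (Algebra.adjoin F {ζ}) E :=
    .comp _ (IntermediateField.adjoin F {ζ}) E
  have _ : Algebra.FormallyEtale (Polynomial F) E := .comp _ (Algebra.adjoin F {ζ}) E
  let e := KaehlerDifferential.tensorKaehlerEquivOfFormallyEtale F (Polynomial F) E
  let D₀ : Derivation F (Polynomial F) E := Polynomial.mkDerivation F (1 : E)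
  have hb := TensorProduct.isBaseChange (Polynomial F) (Ω[Polynomial F⁄F]) E
  refine existsUnique_of_exists_of_unique
    ⟨((hb.lift D₀.liftKaehlerDifferential).comp e.symm.toLinearMap).compDer
      (KaehlerDifferential.D F E), ?_⟩ ?_
  · change hb.lift D₀.liftKaehlerDifferential (e.symm (KaehlerDifferential.D F E ζ)) = 1
    rw [← hX, KaehlerDifferential.tensorKaehlerEquivOfFormallyEtale_symm_D_algebraMap]
    refine (hb.lift_eq D₀.liftKaehlerDifferential
      (KaehlerDifferential.D F (Polynomial F) Polynomial.X)).trans ?_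
    rw [Derivation.liftKaehlerDifferential_comp_D]
    exact Polynomial.mkDerivation_X F (1 : E)
  · intro D D' hD hD'
    have h1 : D.compAlgebraMap (Polynomial F) = D'.compAlgebraMap (Polynomial F) :=
      Polynomial.derivation_ext (by
        change D (algebraMap (Polynomial F) E Polynomial.X) =
          D' (algebraMap (Polynomial F) E Polynomial.X)
        rw [hX, hD, hD'])
    have h2 : D.liftKaehlerDifferential ∘ₗ e.toLinearMap =
        D'.liftKaehlerDifferential ∘ₗ e.toLinearMap := by
      apply hb.algHom_ext
      intro ω
      have hω : ω ∈ Submodule.span (Polynomial F)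
          (Set.range (KaehlerDifferential.D F (Polynomial F))) := by
        rw [KaehlerDifferential.span_range_derivation]; trivial
      induction hω using Submodule.span_induction with
      | mem _ h =>
        obtain ⟨q, rfl⟩ := h
        simpa [e] using DFunLike.congr_fun h1 q
      | zero => simp
      | add a b _ _ ha hb => simp only [map_add, ha, hb]
      | smul c a _ ha =>
        rw [map_smul, ← algebraMap_smul E c, map_smul, map_smul, ha]
    ext x
    have h3 := LinearMap.congr_fun h2 (e.symm (KaehlerDifferential.D F E x))
    simpa using h3

/-- The first Hasse derivative `D_ζ^{(1)}` on `E` with respect to the separating element `ζ`: the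
unique `F`-derivation of `E` taking the value `1` at `ζ`. -/
def IsSeparatingElement.hasseDeriv {F E : Type*} [Field F] [Field E] [Algebra F E] {ζ : E}
    (hζ : IsSeparatingElement F ζ) : Derivation F E E :=
  hζ.existsUnique_derivation.choose

/-! ### Projective varieties and curves over an algebraically closed field -/

/-- The affine cone (without its vertex) over a set of points of `ℙⁿ(K)`. -/
def puncturedCone {K : Type*} [Field K] {n : ℕ} (Y : Set (ℙ K (Fin (n + 1) → K))) :
    Set (Fin (n + 1) → K) :=
  {v | ∃ hv : v ≠ 0, Projectivization.mk K v hv ∈ Y}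

/-- The homogeneous ideal of a set of points of `ℙⁿ(K)` (with `K` infinite): the polynomials
vanishing at all the homogeneous coordinate vectors of all the points. -/
def projIdeal {K : Type*} [Field K] {n : ℕ} (Y : Set (ℙ K (Fin (n + 1) → K))) :
    Ideal (MvPolynomial (Fin (n + 1)) K) :=
  MvPolynomial.vanishingIdeal K (puncturedCone Y)

/-- An irreducible closed subset of `ℙⁿ(K)`, `K` an algebraically closed field. -/
structure ProjVariety (K : Type*) [Field K] (n : ℕ) where
  carrier : Set (ℙ K (Fin (n + 1) → K))
  /-- `carrier` is the common zero set of a set of homogeneous polynomials. -/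
  isClosed : ∃ T : Set (MvPolynomial (Fin (n + 1)) K), (∀ f ∈ T, ∃ d, f.IsHomogeneous d) ∧
    ∀ P, P ∈ carrier ↔ ∀ f ∈ T, MvPolynomial.eval P.rep f = 0
  isPrime : (projIdeal carrier).IsPrime

namespace ProjVariety

variable {K : Type*} [Field K] {n : ℕ} (Y : ProjVariety K n)

instance : (projIdeal Y.carrier).IsPrime := Y.isPrime

/-- The homogeneous coordinate ring `K[Y₀, …, Yₙ] / I(Y)`. -/
abbrev CoordinateRing : Type _ := MvPolynomial (Fin (n + 1)) K ⧸ projIdeal Y.carrier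

/-- The fraction field of the homogeneous coordinate ring (the function field of the cone). -/
abbrev ConeField : Type _ := FractionRing Y.CoordinateRing

/-- The class of the homogeneous coordinate `Yᵢ`. -/
def coord (i : Fin (n + 1)) : Y.ConeField :=
  algebraMap Y.CoordinateRing Y.ConeField
    (Ideal.Quotient.mk (projIdeal Y.carrier) (MvPolynomial.X i))

/-- The function field `F(Y)` for a subfield `F` of `K`: it is generated over `F` by the ratios
`Yᵢ / Yⱼ` of the homogeneous coordinates. For `F = K` it is the field of all
quotients of homogeneous elements of the same degree of the coordinate ring. -/
def functionField (F : Type*) [Field F] [Algebra F K] : IntermediateField F Y.ConeField :=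
  IntermediateField.adjoin F {f | ∃ i j, f = Y.coord i / Y.coord j}

/-- The rational function `Yᵢ / Yⱼ` (for `Yⱼ` not identically zero on `Y`). -/
def ratio (i j : Fin (n + 1)) : Y.functionField K :=
  ⟨Y.coord i / Y.coord j, IntermediateField.subset_adjoin _ _ ⟨i, j, rfl⟩⟩

/-- The inclusion `F(Y) ⊆ K(Y)`. -/
def incl (F : Type*) [Field F] [Algebra F K] : Y.functionField F →ₐ[F] Y.functionField K :=
  IntermediateField.inclusion (F := (Y.functionField K).restrictScalars F)
    (IntermediateField.adjoin_le_iff.mpr (IntermediateField.subset_adjoin K _))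

/-- `Y` is defined over the subfield `F`: its ideal is generated by polynomials over `F`. -/
def IsDefinedOver (F : Type*) [Field F] [Algebra F K] : Prop :=
  ∃ T : Set (MvPolynomial (Fin (n + 1)) F),
    projIdeal Y.carrier = Ideal.span (MvPolynomial.map (algebraMap F K) '' T)

/-- `Y` is contained in no hyperplane. -/
def IsNondegenerate : Prop :=
  ∀ a : Fin (n + 1) → K, a ≠ 0 → ∃ P ∈ Y.carrier, ∑ i, a i * P.rep i ≠ 0

/-- `y₀, …, yₙ ∈ F(Y)` are coordinate functions of `Y`: they are not all zero and
`(y₀ : … : yₙ) = (Y₀ : … : Yₙ)` on `Y`. -/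
def IsCoordinateFunctions {F : Type*} [Field F] [Algebra F K]
    (y : Fin (n + 1) → Y.functionField F) : Prop :=
  y ≠ 0 ∧ ∀ i j, (y i : Y.ConeField) * Y.coord j = (y j : Y.ConeField) * Y.coord i

theorem exists_coord_ne_zero : ∃ j, Y.coord j ≠ 0 := by
  by_contra! h
  apply Y.isPrime.ne_top
  have hc : puncturedCone Y.carrier = ∅ := by
    rw [Set.eq_empty_iff_forall_notMem]
    intro v hv
    apply hv.1
    funext j
    have hj := h j
    rw [coord, FaithfulSMul.algebraMap_eq_zero_iff, Ideal.Quotient.eq_zero_iff_mem] at hj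
    simpa using hj v hv
  rw [projIdeal, hc, MvPolynomial.vanishingIdeal_empty]

/-- A point of the nonsingular model of a curve `Y`: a discrete valuation ring of
`K(Y)` containing `K`. -/
structure ModelPoint where
  ring : ValuationSubring (Y.functionField K)
  algebraMap_mem : ∀ c : K, algebraMap K (Y.functionField K) c ∈ ring
  isDVR : IsDiscreteValuationRing ring

namespace ModelPoint

variable {Y} (P : Y.ModelPoint)

instance : IsDiscreteValuationRing P.ring := P.isDVR

/-- The rational function `f` is regular at `P` and `f(P) = c`. -/
def HasValue (f : Y.functionField K) (c : K) : Prop :=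
  P.ring.valuation (f - algebraMap K (Y.functionField K) c) < 1

theorem exists_chart : ∃ j, Y.coord j ≠ 0 ∧ ∀ i, Y.ratio i j ∈ P.ring := by
  obtain ⟨j₀, hj₀⟩ := Y.exists_coord_ne_zero
  obtain ⟨j, hj⟩ := Finite.exists_max fun i => P.ring.valuation (Y.ratio i j₀)
  have hjz : Y.coord j ≠ 0 := by
    intro h0
    have h1 : Y.ratio j₀ j₀ = 1 := Subtype.ext (div_self hj₀)
    have h2 : Y.ratio j j₀ = 0 := Subtype.ext (by simp [ratio, h0])
    have := hj j₀
    simp [h1, h2] at this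
  refine ⟨j, hjz, fun i => ?_⟩
  have h3 : Y.ratio i j = Y.ratio i j₀ / Y.ratio j j₀ := Subtype.ext (by
    simp only [ratio, IntermediateField.coe_div]
    field_simp)
  have h4 : Y.ratio j j₀ ≠ 0 := fun h => by
    have := congrArg Subtype.val h
    simp [ratio, hjz, hj₀] at this
  rw [← ValuationSubring.valuation_le_one_iff, h3, map_div₀]
  exact div_le_one_of_le₀ (hj i) zero_le

/-- An index `j` such that the point of `Y` below `P` lies in the affine chart `Yⱼ ≠ 0`. -/
def chart : Fin (n + 1) := P.exists_chart.choose

/-- The local equation at `P` of the hyperplane `∑ aᵢ Yᵢ = 0`: the regular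
function `∑ aᵢ Yᵢ / Yⱼ`, where the point of `Y` below `P` lies in the chart `Yⱼ ≠ 0`. -/
def localEquation (a : Fin (n + 1) → K) : P.ring :=
  ∑ i, ⟨algebraMap K _ (a i), P.algebraMap_mem (a i)⟩ *
    ⟨Y.ratio i P.chart, P.exists_chart.choose_spec.2 i⟩

/-- The intersection multiplicity at `P` of `Y` and the hyperplane `∑ aᵢ Yᵢ = 0`: the order of
vanishing at `P` of the local equation of the hyperplane. -/
def intersectionMultiplicity (a : Fin (n + 1) → K) : ℕ∞ :=
  IsDiscreteValuationRing.addVal P.ring (P.localEquation a)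

end ModelPoint

end ProjVariety

/-- A projective curve in `ℙⁿ(K)`: a projective variety of dimension one. -/
structure ProjCurve (K : Type*) [Field K] (n : ℕ) extends ProjVariety K n where
  trdeg_eq_one : Algebra.trdeg K (toProjVariety.functionField K) = 1

end

/-!
Put `q = p ^ r`, fix a place `P` with uniformizer `t`, and write `uᵢ = uᵢ(P) + t cᵢ`. Since the
`q`-th power is additive, the relation `∑ uᵢ ^ q yᵢ = 0` becomes
`∑ uᵢ(P) ^ q yᵢ = - t ^ q ∑ cᵢ ^ q yᵢ`. Once the `yᵢ` are normalized at `P`, this shows that the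
hyperplane `H_P` meets the curve with multiplicity at least `q`, and exactly `q` if and only if
`∑ cᵢ ^ q yᵢ` is a unit at `P`.

For almost all `P`, the Hasse derivative `D` with respect to a fixed separating element `ξ` maps the
valuation ring of `P` into itself. Then `t = ξ - ξ(P)` is a uniformizer, because `D t = 1`, and
`cᵢ ≡ D uᵢ` modulo `t`. Since a nonzero function is a unit at almost all places, `∑ cᵢ ^ q yᵢ` is a
unit at almost all places if `∑ (D uᵢ) ^ q yᵢ` is nonzero, and at none otherwise.
-/

open scoped IntermediateField.algebraAdjoinAdjoin

section SeparatingElement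

variable {F E : Type*} [Field F] [Field E] [Algebra F E]

theorem isAlgebraic_adjoin_of_transcendental (htr : Algebra.trdeg F E = 1) {f : E}
    (hf : Transcendental F f) : Algebra.IsAlgebraic (IntermediateField.adjoin F {f}) E := by
  have hind : AlgebraicIndependent F (fun _ : PUnit => f) :=
    algebraicIndependent_unique_type_iff.mpr hf
  have := (hind.isTranscendenceBasis_of_trdeg_le_of_finite (by simp [htr])).isAlgebraic_field
  rwa [Set.range_const] at this

theorem exists_isSeparatingElement [PerfectField F] [Algebra.EssFiniteType F E]
    (htr : Algebra.trdeg F E = 1) : ∃ ζ : E, IsSeparatingElement F ζ := by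
  obtain ⟨s, hs, hsep⟩ := exists_isTranscendenceBasis_and_isSeparable_of_perfectField F E
  have hcard : s.card = 1 := by
    have := hs.cardinalMk_eq_trdeg
    rwa [htr, Cardinal.mk_coe_finset, Nat.cast_eq_one] at this
  obtain ⟨ζ, rfl⟩ := Finset.card_eq_one.mp hcard
  exact ⟨ζ, hs.1.transcendental ⟨ζ, Finset.mem_singleton_self ζ⟩,
    by rwa [Finset.coe_singleton] at hsep⟩

theorem isPrincipalIdealRing_adjoin_singleton (ζ : E) :
    IsPrincipalIdealRing (Algebra.adjoin F {ζ}) := by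
  rw [Algebra.adjoin_singleton_eq_range_aeval]
  exact .of_surjective _ (Polynomial.aeval ζ).rangeRestrict_surjective

theorem derivation_eq_zero_of_mem_adjoin {ζ : E} {M : Type*} [AddCommGroup M] [Module F M]
    [Module E M] (D : Derivation F E M) (h : D ζ = 0) {x : E}
    (hx : x ∈ IntermediateField.adjoin F {ζ}) : D x = 0 := by
  induction hx using IntermediateField.adjoin_induction with
  | mem x hx => rwa [Set.mem_singleton_iff.mp hx]
  | algebraMap a => exact D.map_algebraMap a
  | add x y _ _ hx hy => rw [map_add, hx, hy, add_zero]
  | inv x _ hx => rw [Derivation.leibniz_inv, hx, smul_zero]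
  | mul x y _ _ hx hy => rw [Derivation.leibniz, hx, hy, smul_zero, smul_zero, add_zero]

namespace IsSeparatingElement

variable {ζ ξ : E}

theorem inv (hζ : IsSeparatingElement F ζ) : IsSeparatingElement F ζ⁻¹ where
  transcendental h := hζ.transcendental (IsAlgebraic.inv_iff.mp h)
  isSeparable := by
    have h : IntermediateField.adjoin F {ζ⁻¹} = IntermediateField.adjoin F {ζ} := by
      apply le_antisymm <;> rw [IntermediateField.adjoin_simple_le_iff]
      · exact inv_mem (IntermediateField.mem_adjoin_simple_self F ζ)
      · exact inv_mem_iff.mp (IntermediateField.mem_adjoin_simple_self F ζ⁻¹)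
    rw [h]
    exact hζ.isSeparable

theorem derivation_eq_zero {M : Type*} [AddCommGroup M] [Module F M] [Module E M]
    (hζ : IsSeparatingElement F ζ) (D : Derivation F E M) (h : D ζ = 0) : D = 0 := by
  let D' : Derivation (IntermediateField.adjoin F {ζ}) E M :=
    { D with
      map_smul' := fun c x => by
        have hc : D c = 0 := derivation_eq_zero_of_mem_adjoin D h c.2
        change D ((c : E) * x) = (c : E) • D x
        rw [Derivation.leibniz, hc, smul_zero, add_zero] }
  have := hζ.isSeparable
  ext x
  have hx := D'.map_aeval (minpoly (IntermediateField.adjoin F {ζ}) x) x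
  rw [minpoly.aeval, map_zero] at hx
  exact (smul_eq_zero.mp hx.symm).resolve_left
    ((Algebra.IsSeparable.isSeparable _ x).aeval_derivative_ne_zero (minpoly.aeval _ x))

theorem hasseDeriv_self (hζ : IsSeparatingElement F ζ) : hζ.hasseDeriv ζ = 1 :=
  hζ.existsUnique_derivation.choose_spec.1

theorem hasseDeriv_eq_smul (hζ : IsSeparatingElement F ζ) (hξ : IsSeparatingElement F ξ) :
    hζ.hasseDeriv = hζ.hasseDeriv ξ • hξ.hasseDeriv := by
  rw [← sub_eq_zero]
  apply hξ.derivation_eq_zero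
  simp [hξ.hasseDeriv_self]

theorem hasseDeriv_ne_zero (hζ : IsSeparatingElement F ζ) (hξ : IsSeparatingElement F ξ) :
    hζ.hasseDeriv ξ ≠ 0 := by
  intro h
  have h1 := hζ.hasseDeriv_self
  rw [hζ.hasseDeriv_eq_smul hξ, h, zero_smul, Derivation.zero_apply] at h1
  exact zero_ne_one h1

theorem sum_hasseDeriv_pow_mul_eq_zero_iff {ι : Type*} [Fintype ι] (hζ : IsSeparatingElement F ζ)
    (hξ : IsSeparatingElement F ξ) (u y : ι → E) (q : ℕ) :
    ∑ i, hζ.hasseDeriv (u i) ^ q * y i = 0 ↔ ∑ i, hξ.hasseDeriv (u i) ^ q * y i = 0 := by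
  have h : ∑ i, hζ.hasseDeriv (u i) ^ q * y i =
      hζ.hasseDeriv ξ ^ q * ∑ i, hξ.hasseDeriv (u i) ^ q * y i := by
    rw [Finset.mul_sum]
    refine Finset.sum_congr rfl fun i _ => ?_
    rw [DFunLike.congr_fun (hζ.hasseDeriv_eq_smul hξ) (u i), Derivation.smul_apply, smul_eq_mul,
      mul_pow, mul_assoc]
  rw [h, mul_eq_zero_iff_left (pow_ne_zero q (hζ.hasseDeriv_ne_zero hξ))]

section IntegralClosure

variable [Algebra.EssFiniteType F E]

theorem finite_adjoin (hζ : IsSeparatingElement F ζ) :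
    Module.Finite (IntermediateField.adjoin F {ζ}) E := by
  have := hζ.isSeparable
  have : Algebra.EssFiniteType (IntermediateField.adjoin F {ζ}) E := .of_comp F _ E
  exact Algebra.finite_of_essFiniteType_of_isAlgebraic

theorem isDedekindDomain_integralClosure (hζ : IsSeparatingElement F ζ) :
    IsDedekindDomain (integralClosure (Algebra.adjoin F {ζ}) E) := by
  have := hζ.isSeparable
  have := hζ.finite_adjoin
  have := isPrincipalIdealRing_adjoin_singleton (F := F) ζ
  exact integralClosure.isDedekindDomain _ (IntermediateField.adjoin F {ζ}) E

theorem isFractionRing_integralClosure (hζ : IsSeparatingElement F ζ) :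
    IsFractionRing (integralClosure (Algebra.adjoin F {ζ}) E) E := by
  have := hζ.finite_adjoin
  exact integralClosure.isFractionRing_of_finite_extension (IntermediateField.adjoin F {ζ}) E

theorem finiteType_integralClosure (hζ : IsSeparatingElement F ζ) :
    Algebra.FiniteType F (integralClosure (Algebra.adjoin F {ζ}) E) := by
  have := hζ.isSeparable
  have := hζ.finite_adjoin
  have := isPrincipalIdealRing_adjoin_singleton (F := F) ζ
  have hfin : Module.Finite (Algebra.adjoin F {ζ}) (integralClosure (Algebra.adjoin F {ζ}) E) :=
    IsIntegralClosure.finite _ (IntermediateField.adjoin F {ζ}) E _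
  exact (Algebra.FiniteType.adjoin_of_finite (Set.finite_singleton ζ)).trans inferInstance

end IntegralClosure

end IsSeparatingElement

end SeparatingElement

section ConstantExtension

variable {k K E L : Type*} [Field k] [Field K] [Field E] [Field L] [Algebra k K] [Algebra k E]
  [Algebra k L] [Algebra K L] [IsScalarTower k K L]

theorem isSeparable_adjoin_map {ζ : E} [Algebra.IsSeparable (IntermediateField.adjoin k {ζ}) E]
    (σ : E →ₐ[k] L) (hσ : IntermediateField.adjoin K (Set.range σ) = ⊤) :
    Algebra.IsSeparable (IntermediateField.adjoin K {σ ζ}) L := by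
  let E₀ := IntermediateField.adjoin k {ζ}
  let L₀ := IntermediateField.adjoin K {σ ζ}
  have hle : E₀ ≤ (L₀.restrictScalars k).comap σ :=
    IntermediateField.adjoin_simple_le_iff.mpr (IntermediateField.mem_adjoin_simple_self K (σ ζ))
  let φ : E₀ →+* L₀ :=
    ((σ : E →+* L).comp (algebraMap E₀ E)).codRestrict L₀.toSubring fun a => hle a.2
  have hsep (z : E) : IsSeparable L₀ (σ z) := by
    have hroot : Polynomial.aeval (σ z) ((minpoly E₀ z).map φ) = 0 := by
      have h := congrArg σ (minpoly.aeval E₀ z)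
      rw [Polynomial.aeval_def, map_zero] at h
      rw [Polynomial.aeval_def, Polynomial.eval₂_map, ← h]
      exact (Polynomial.hom_eval₂ _ _ (σ : E →+* L) z).symm
    have hz : (minpoly E₀ z).Separable := Algebra.IsSeparable.isSeparable E₀ z
    exact hz.map.of_dvd (minpoly.dvd _ _ hroot)
  have htop : (separableClosure L₀ L).restrictScalars K = ⊤ := by
    rw [eq_top_iff, ← hσ, IntermediateField.adjoin_le_iff]
    rintro _ ⟨z, rfl⟩
    exact mem_separableClosure_iff.mpr (hsep z)
  exact ⟨fun x => mem_separableClosure_iff.mp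
    (htop ▸ IntermediateField.mem_top : x ∈ (separableClosure L₀ L).restrictScalars K)⟩

theorem IsSeparatingElement.map [Algebra.Transcendental K L] {ζ : E}
    (hζ : IsSeparatingElement k ζ) (σ : E →ₐ[k] L)
    (hσ : IntermediateField.adjoin K (Set.range σ) = ⊤) : IsSeparatingElement K (σ ζ) := by
  have := hζ.isSeparable
  have hsep := isSeparable_adjoin_map (K := K) (ζ := ζ) σ hσ
  refine ⟨fun halg => ?_, hsep⟩
  have : Algebra.IsAlgebraic K (IntermediateField.adjoin K {σ ζ}) :=
    IntermediateField.isAlgebraic_adjoin_simple halg.isIntegral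
  exact Algebra.transcendental_iff_not_isAlgebraic.mp ‹_›
    (Algebra.IsAlgebraic.trans K (IntermediateField.adjoin K {σ ζ}) L)

theorem IsSeparatingElement.hasseDeriv_map {ζ : E} (hζ : IsSeparatingElement k ζ) (σ : E →ₐ[k] L)
    (hσζ : IsSeparatingElement K (σ ζ)) (z : E) :
    hσζ.hasseDeriv (σ z) = σ (hζ.hasseDeriv z) := by
  let _ : Algebra E L := σ.toRingHom.toAlgebra
  have _ : IsScalarTower k E L := IsScalarTower.of_algebraMap_eq fun a => (σ.commutes a).symm
  let D : Derivation k E L := (hσζ.hasseDeriv.restrictScalars k).compAlgebraMap E -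
    (Algebra.linearMap E L).compDer hζ.hasseDeriv
  have hD (x : E) : D x = hσζ.hasseDeriv (σ x) - σ (hζ.hasseDeriv x) := rfl
  have hD0 : D = 0 := hζ.derivation_eq_zero D (by
    rw [hD, hσζ.hasseDeriv_self, hζ.hasseDeriv_self, map_one, sub_self])
  rw [← sub_eq_zero, ← hD, hD0, Derivation.zero_apply]

end ConstantExtension

section DedekindCentre

open IsDedekindDomain

variable {L : Type*} [Field L] {R : Type*} [CommRing R] [Algebra R L] {P : ValuationSubring L}

theorem mem_valuationSubring_of_isIntegral (hR : ∀ a, algebraMap R L a ∈ P) {x : L}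
    (hx : IsIntegral R x) : x ∈ P := by
  have hx' : IsIntegral P x :=
    hx.map_of_comp_eq ((algebraMap R L).codRestrict P.toSubring hR) (RingHom.id L) rfl
  obtain ⟨y, rfl⟩ := IsIntegrallyClosed.isIntegral_iff.mp hx'
  exact y.2

theorem mem_valuationSubring_of_mem_adjoin (hR : ∀ a, algebraMap R L a ∈ P) {S : Set L}
    (hS : S ⊆ P) {x : L} (hx : x ∈ Algebra.adjoin R S) : x ∈ P :=
  Algebra.adjoin_le (S := { P.toSubring with algebraMap_mem' := hR }) hS hx

variable [IsDedekindDomain R] [IsFractionRing R L]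

theorem exists_valuationSubringAtPrime_eq (hR : ∀ a, algebraMap R L a ∈ P) (hP : P ≠ ⊤) :
    ∃ v : HeightOneSpectrum R, v.valuationSubringAtPrime L = P := by
  let Q : Ideal R :=
    (IsLocalRing.maximalIdeal P).comap ((algebraMap R L).codRestrict P.toSubring hR)
  have hinv (s : R) (hs : s ∉ Q) : (algebraMap R L s)⁻¹ ∈ P := by
    by_contra h
    exact hs (P.coe_mem_nonunits_iff.mp (P.mem_nonunits_iff_or.mpr (Or.inr h)))
  have hQ : Q ≠ ⊥ := by
    intro hQ
    refine hP (eq_top_iff.mpr fun f _ => ?_)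
    obtain ⟨a, s, hs, rfl⟩ := IsFractionRing.div_surjective (A := R) f
    exact div_eq_mul_inv (algebraMap R L a) _ ▸ mul_mem (hR a)
      (hinv s (by simpa [hQ] using nonZeroDivisors.ne_zero hs))
  refine ⟨⟨Q, Ideal.IsPrime.comap _, hQ⟩, ValuationSubring.eq_of_le_of_ne_top _ ?_ hP⟩
  rintro _ ⟨a, s, hs, rfl⟩
  exact mul_mem (hR a) (hinv s hs)

variable (R) in
theorem finite_setOf_notMem_of_isDedekindDomain (f : L) :
    {P : ValuationSubring L | (∀ a, algebraMap R L a ∈ P) ∧ f ∉ P}.Finite := by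
  refine ((HeightOneSpectrum.Support.finite R f).image
    (HeightOneSpectrum.valuationSubringAtPrime L)).subset ?_
  rintro P ⟨hR, hf⟩
  have hP : P ≠ ⊤ := by
    rintro rfl
    exact hf (ValuationSubring.mem_top f)
  obtain ⟨v, rfl⟩ := exists_valuationSubringAtPrime_eq hR hP
  rw [HeightOneSpectrum.valuationSubringAtPrime_eq_valuationSubring,
    Valuation.mem_valuationSubring_iff, not_le] at hf
  exact ⟨v, hf, rfl⟩

theorem derivation_mem_of_isDedekindDomain {k : Type*} [CommRing k] [Algebra k L]
    (D : Derivation k L L) (hR : ∀ a, algebraMap R L a ∈ P)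
    (hD : ∀ a, D (algebraMap R L a) ∈ P) {f : L} (hf : f ∈ P) : D f ∈ P := by
  rcases eq_or_ne P ⊤ with rfl | hP
  · exact ValuationSubring.mem_top _
  obtain ⟨v, rfl⟩ := exists_valuationSubringAtPrime_eq hR hP
  obtain ⟨a, s, hs, rfl⟩ := hf
  have hs' : (algebraMap R L s)⁻¹ ∈ v.valuationSubringAtPrime L :=
    ⟨1, s, hs, by rw [map_one, one_mul]⟩
  rw [D.leibniz, D.leibniz_inv]
  simp only [smul_eq_mul]
  exact add_mem (mul_mem (hR a) (mul_mem (neg_mem (pow_mem hs' 2)) (hD s))) (mul_mem hs' (hD a))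

end DedekindCentre

section ResidueField

variable {K L : Type*} [Field K] [Field L] [Algebra K L] {P : ValuationSubring L}

theorem valuation_algebraMap_eq_one (hK : ∀ c, algebraMap K L c ∈ P) {c : K} (hc : c ≠ 0) :
    P.valuation (algebraMap K L c) = 1 :=
  (P.valuation_eq_one_iff _).mp
    ((IsUnit.mk0 c hc).map ((algebraMap K L).codRestrict P.toSubring hK))

theorem valuation_aeval_eq_one [IsAlgClosed K] (hK : ∀ c, algebraMap K L c ∈ P) {f : L}
    (hf : ∀ c, P.valuation (f - algebraMap K L c) = 1) {q : Polynomial K} (hq : q ≠ 0) :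
    P.valuation (Polynomial.aeval f q) = 1 := by
  rw [(IsAlgClosed.splits q).eq_prod_roots, map_mul, map_multiset_prod, Multiset.map_map,
    map_mul, map_multiset_prod, Multiset.map_map, Polynomial.aeval_C,
    valuation_algebraMap_eq_one hK (Polynomial.leadingCoeff_ne_zero.mpr hq), one_mul]
  refine Multiset.prod_eq_one fun x hx => ?_
  obtain ⟨c, -, rfl⟩ := Multiset.mem_map.mp hx
  simpa using hf c

theorem mem_of_mem_adjoin_of_valuation_sub_eq_one [IsAlgClosed K] (hK : ∀ c, algebraMap K L c ∈ P)
    {f : L} (hf : ∀ c, P.valuation (f - algebraMap K L c) = 1) {x : L}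
    (hx : x ∈ IntermediateField.adjoin K {f}) : x ∈ P := by
  obtain ⟨a, s, rfl⟩ := (IntermediateField.mem_adjoin_simple_iff K x).mp hx
  rcases eq_or_ne a 0 with rfl | ha
  · simp [P.zero_mem]
  rcases eq_or_ne s 0 with rfl | hs
  · simp [P.zero_mem]
  rw [← P.valuation_le_one_iff, map_div₀, valuation_aeval_eq_one hK hf ha,
    valuation_aeval_eq_one hK hf hs, div_one]

theorem exists_sub_algebraMap_mem_nonunits [IsAlgClosed K] (htr : Algebra.trdeg K L = 1)
    (hK : ∀ c, algebraMap K L c ∈ P) (hP : P ≠ ⊤) {f : L} (hf : f ∈ P) :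
    ∃ c, f - algebraMap K L c ∈ P.nonunits := by
  by_contra! h
  have hval (c : K) : P.valuation (f - algebraMap K L c) = 1 :=
    ((P.valuation_le_one_iff _).mpr (sub_mem hf (hK c))).eq_of_not_lt (h c)
  have htrans : Transcendental K f := by
    rintro ⟨q, hq, hq0⟩
    simpa [hq0] using valuation_aeval_eq_one hK hval hq
  have := isAlgebraic_adjoin_of_transcendental htr htrans
  refine hP (eq_top_iff.mpr fun x _ => ?_)
  exact mem_valuationSubring_of_isIntegral (R := IntermediateField.adjoin K {f})
    (fun a => mem_of_mem_adjoin_of_valuation_sub_eq_one hK hval a.2)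
    (Algebra.IsAlgebraic.isAlgebraic x).isIntegral

end ResidueField

section CofinitePlaces

open Filter

variable {K L : Type*} [Field K] [Field L] [Algebra K L]

variable (K L) in
/-- The filter of all but finitely many places of `L / K`, a place being encoded as a valuation
ring of `L` containing `K`. The trivial valuation ring `L` counts as a place; this is harmless for
statements about almost all places. -/
def cofinitePlaces : Filter (ValuationSubring L) :=
  cofinite ⊓ 𝓟 {P | ∀ c : K, algebraMap K L c ∈ P}

theorem eventually_cofinitePlaces_iff {p : ValuationSubring L → Prop} :
    (∀ᶠ P in cofinitePlaces K L, p P) ↔ {P | (∀ c : K, algebraMap K L c ∈ P) ∧ ¬ p P}.Finite := by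
  simp [cofinitePlaces, eventually_inf_principal, eventually_cofinite]

theorem cofinitePlaces.eventually_algebraMap_mem :
    ∀ᶠ P in cofinitePlaces K L, ∀ c : K, algebraMap K L c ∈ P :=
  mem_inf_of_right (mem_principal_self _)

variable [Algebra.EssFiniteType K L]

theorem IsSeparatingElement.eventually_mem_of_mem {ζ : L} (hζ : IsSeparatingElement K ζ) (f : L) :
    ∀ᶠ P in cofinitePlaces K L, ζ ∈ P → f ∈ P := by
  have := hζ.isDedekindDomain_integralClosure
  have := hζ.isFractionRing_integralClosure
  rw [eventually_cofinitePlaces_iff]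
  refine (finite_setOf_notMem_of_isDedekindDomain
    (integralClosure (Algebra.adjoin K {ζ}) L) f).subset ?_
  rintro P ⟨hK, hP⟩
  obtain ⟨hζP, hfP⟩ := Classical.not_imp.mp hP
  have hA (a : Algebra.adjoin K {ζ}) : (a : L) ∈ P :=
    mem_valuationSubring_of_mem_adjoin hK (Set.singleton_subset_iff.mpr hζP) a.2
  exact ⟨fun a => mem_valuationSubring_of_isIntegral hA a.2, hfP⟩

variable [PerfectField K]

theorem cofinitePlaces.eventually_mem (htr : Algebra.trdeg K L = 1) (f : L) :
    ∀ᶠ P in cofinitePlaces K L, f ∈ P := by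
  obtain ⟨ζ, hζ⟩ := exists_isSeparatingElement (F := K) (E := L) htr
  filter_upwards [hζ.eventually_mem_of_mem f, hζ.inv.eventually_mem_of_mem f] with P hP hP'
  exact (P.mem_or_inv_mem ζ).elim hP hP'

theorem cofinitePlaces.eventually_valuation_eq_one (htr : Algebra.trdeg K L = 1) {f : L}
    (hf : f ≠ 0) : ∀ᶠ P in cofinitePlaces K L, P.valuation f = 1 := by
  filter_upwards [cofinitePlaces.eventually_mem htr f, cofinitePlaces.eventually_mem htr f⁻¹]
    with P hfP hfP'
  refine le_antisymm ((P.valuation_le_one_iff f).mpr hfP) ?_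
  rw [← P.valuation_le_one_iff, map_inv₀] at hfP'
  exact (inv_le_one₀ (zero_lt_iff.mpr ((Valuation.ne_zero_iff _).mpr hf))).mp hfP'

theorem cofinitePlaces.eventually_derivation_algebraMap_mem {R : Type*} [CommRing R] [Algebra K R]
    [Algebra R L] [IsScalarTower K R L] [Algebra.FiniteType K R] (htr : Algebra.trdeg K L = 1)
    (D : Derivation K L L) :
    ∀ᶠ P in cofinitePlaces K L, ∀ a : R, algebraMap R L a ∈ P ∧ D (algebraMap R L a) ∈ P := by
  obtain ⟨S, hgen⟩ := Algebra.FiniteType.out (R := K) (A := R)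
  filter_upwards [cofinitePlaces.eventually_algebraMap_mem,
    (eventually_all_finset S).mpr fun s _ => cofinitePlaces.eventually_mem htr (algebraMap R L s),
    (eventually_all_finset S).mpr fun s _ =>
      cofinitePlaces.eventually_mem htr (D (algebraMap R L s))]
    with P hK hS hDS a
  have ha : a ∈ Algebra.adjoin K (S : Set R) := hgen ▸ Algebra.mem_top
  induction ha using Algebra.adjoin_induction with
  | mem s hs => exact ⟨hS s hs, hDS s hs⟩
  | algebraMap c =>
    rw [← IsScalarTower.algebraMap_apply, D.map_algebraMap]
    exact ⟨hK c, zero_mem P⟩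
  | add a b _ _ ha hb =>
    rw [map_add, map_add]
    exact ⟨add_mem ha.1 hb.1, add_mem ha.2 hb.2⟩
  | mul a b _ _ ha hb =>
    rw [map_mul, D.leibniz]
    exact ⟨mul_mem ha.1 hb.1, add_mem (mul_mem ha.1 hb.2) (mul_mem hb.1 ha.2)⟩

theorem cofinitePlaces.eventually_derivation_mem (htr : Algebra.trdeg K L = 1)
    (D : Derivation K L L) : ∀ᶠ P in cofinitePlaces K L, ∀ f ∈ P, D f ∈ P := by
  obtain ⟨ζ, hζ⟩ := exists_isSeparatingElement (F := K) (E := L) htr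
  have := hζ.isDedekindDomain_integralClosure
  have := hζ.isFractionRing_integralClosure
  have := hζ.finiteType_integralClosure
  filter_upwards [cofinitePlaces.eventually_derivation_algebraMap_mem
    (R := integralClosure (Algebra.adjoin K {ζ}) L) htr D] with P hP f hf
  exact derivation_mem_of_isDedekindDomain D (fun a => (hP a).1) (fun a => (hP a).2) hf

end CofinitePlaces

section FrobeniusTwist

theorem sum_add_mul_pow_expChar_pow_mul {R : Type*} [CommSemiring R] (p : ℕ) [ExpChar R p]
    {ι : Type*} [Fintype ι] (r : ℕ) (b c x : ι → R) (t : R) :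
    ∑ i, (b i + t * c i) ^ p ^ r * x i =
      ∑ i, b i ^ p ^ r * x i + t ^ p ^ r * ∑ i, c i ^ p ^ r * x i := by
  rw [Finset.mul_sum, ← Finset.sum_add_distrib]
  refine Finset.sum_congr rfl fun i _ => ?_
  rw [add_pow_expChar_pow, mul_pow, add_mul, mul_assoc]

theorem isUnit_sum_add_mul_pow_expChar_pow_mul_iff {R : Type*} [CommRing R] [IsLocalRing R] (p : ℕ)
    [ExpChar R p] {ι : Type*} [Fintype ι] (r : ℕ) (b c x : ι → R) {t : R}
    (ht : t ∈ IsLocalRing.maximalIdeal R) :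
    IsUnit (∑ i, (b i + t * c i) ^ p ^ r * x i) ↔ IsUnit (∑ i, b i ^ p ^ r * x i) := by
  rw [sum_add_mul_pow_expChar_pow_mul, ← not_iff_not]
  exact (IsLocalRing.maximalIdeal R).add_mem_iff_left
    (Ideal.mul_mem_right _ _ (Ideal.pow_mem_of_mem _ ht _ (pow_pos (expChar_pos R p) r)))

open IsDiscreteValuationRing

variable {R : Type*} [CommRing R] [IsDomain R] [IsDiscreteValuationRing R]

theorem exists_eq_add_mul_of_irreducible {ι : Type*} {t : R} (ht : Irreducible t) {u b : ι → R}
    (hub : ∀ i, u i - b i ∈ IsLocalRing.maximalIdeal R) :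
    ∃ c : ι → R, ∀ i, u i = b i + t * c i := by
  have hdvd (i : ι) : ∃ c, u i = b i + t * c := by
    simpa only [ht.maximalIdeal_eq, Ideal.mem_span_singleton, dvd_def, sub_eq_iff_eq_add']
      using hub i
  exact Classical.skolem.mp hdvd

variable (p : ℕ) [ExpChar R p] {ι : Type*} [Fintype ι] (r : ℕ)

theorem addVal_sum_pow_mul_of_sum_add_mul_eq_zero {t : R} (ht : Irreducible t) {b c x : ι → R}
    (h : ∑ i, (b i + t * c i) ^ p ^ r * x i = 0) :
    addVal R (∑ i, b i ^ p ^ r * x i) = (p ^ r : ℕ) + addVal R (∑ i, c i ^ p ^ r * x i) := by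
  rw [sum_add_mul_pow_expChar_pow_mul] at h
  rw [eq_neg_of_add_eq_zero_left h, AddValuation.map_neg, addVal_mul, ht.addVal_pow]

theorem le_addVal_sum_pow_mul {u b x : ι → R}
    (hub : ∀ i, u i - b i ∈ IsLocalRing.maximalIdeal R) (hrel : ∑ i, u i ^ p ^ r * x i = 0) :
    (p ^ r : ℕ) ≤ addVal R (∑ i, b i ^ p ^ r * x i) := by
  obtain ⟨t, ht⟩ := IsDiscreteValuationRing.exists_irreducible R
  obtain ⟨c, hc⟩ := exists_eq_add_mul_of_irreducible ht hub
  simp only [hc] at hrel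
  rw [addVal_sum_pow_mul_of_sum_add_mul_eq_zero p r ht hrel]
  exact le_self_add

section Derivation

variable {K : Type*} [CommRing K] [Algebra K R] (δ : Derivation K R R) {t : R}

theorem irreducible_of_derivation_eq_one (ht : t ∈ IsLocalRing.maximalIdeal R) (hδt : δ t = 1) :
    Irreducible t := by
  obtain ⟨ϖ, hϖ⟩ := IsDiscreteValuationRing.exists_irreducible R
  obtain ⟨c, rfl⟩ : ϖ ∣ t := by rwa [← Ideal.mem_span_singleton, ← hϖ.maximalIdeal_eq]
  refine (irreducible_mul_isUnit ?_).mpr hϖ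
  by_contra hc
  have hmem : ϖ • δ c + c • δ ϖ ∈ IsLocalRing.maximalIdeal R :=
    add_mem (Ideal.mul_mem_right _ _ hϖ.not_isUnit) (Ideal.mul_mem_right _ _ hc)
  rw [← δ.leibniz, hδt] at hmem
  exact hmem isUnit_one

theorem addVal_sum_pow_mul_eq_iff (ht : t ∈ IsLocalRing.maximalIdeal R) (hδt : δ t = 1)
    {u x : ι → R} {b : ι → K} (hub : ∀ i, u i - algebraMap K R (b i) ∈ IsLocalRing.maximalIdeal R)
    (hrel : ∑ i, u i ^ p ^ r * x i = 0) :
    addVal R (∑ i, algebraMap K R (b i) ^ p ^ r * x i) = (p ^ r : ℕ) ↔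
      IsUnit (∑ i, δ (u i) ^ p ^ r * x i) := by
  have hirr := irreducible_of_derivation_eq_one δ ht hδt
  obtain ⟨c, hc⟩ := exists_eq_add_mul_of_irreducible hirr hub
  have hδu (i : ι) : δ (u i) = c i + t * δ (c i) := by
    rw [hc, map_add, δ.map_algebraMap, zero_add, δ.leibniz, hδt, smul_eq_mul, smul_eq_mul, mul_one,
      add_comm]
  simp only [hδu]
  rw [isUnit_sum_add_mul_pow_expChar_pow_mul_iff p r _ _ _ ht]
  simp only [hc] at hrel
  rw [addVal_sum_pow_mul_of_sum_add_mul_eq_zero p r hirr hrel, ← addVal_eq_zero_iff]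
  exact (ENat.add_right_injective_of_ne_top (ENat.natCast_ne_top (p ^ r))).eq_iff' (add_zero _)

end Derivation

end FrobeniusTwist

section RestrictDerivation

variable {K L : Type*} [CommRing K] [Field L] [Algebra K L] (P : ValuationSubring L) [Algebra K P]
  [IsScalarTower K P L]

/-- The derivation of a valuation ring `P` induced by a derivation of its fraction field that maps
`P` into itself. -/
noncomputable def restrictDerivation (D : Derivation K L L) (hD : ∀ f ∈ P, D f ∈ P) :
    Derivation K P P :=
  .mk'
    { toFun f := ⟨D f, hD f f.2⟩
      map_add' f g := Subtype.ext (map_add D (f : L) (g : L))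
      map_smul' c f := Subtype.ext <| by
        have hcoe (g : P) : ((c • g : P) : L) = c • (g : L) :=
          map_smul (IsScalarTower.toAlgHom K P L) c g
        exact (congrArg D (hcoe f)).trans ((D.map_smul c (f : L)).trans
          (hcoe ⟨D f, hD f f.2⟩).symm) }
    fun f g => Subtype.ext (D.leibniz (f : L) (g : L))

end RestrictDerivation

namespace ProjVariety

variable {K : Type*} [Field K] {n : ℕ} (Y : ProjVariety K n)

instance essFiniteType_functionField : Algebra.EssFiniteType K (Y.functionField K) := by
  rw [IntermediateField.essFiniteType_iff]
  refine IntermediateField.fg_adjoin_of_finite ?_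
  refine (Set.finite_range fun ij : Fin (n + 1) × Fin (n + 1) =>
    Y.coord ij.1 / Y.coord ij.2).subset ?_
  rintro _ ⟨i, j, rfl⟩
  exact ⟨(i, j), rfl⟩

theorem adjoin_range_incl (F : Type*) [Field F] [Algebra F K] :
    IntermediateField.adjoin K (Set.range (Y.incl F)) = ⊤ := by
  rw [eq_top_iff]
  rintro ⟨x, hx⟩ -
  induction hx using IntermediateField.adjoin_induction with
  | mem x hx =>
    obtain ⟨i, j, rfl⟩ := hx
    refine IntermediateField.subset_adjoin _ _ ⟨⟨Y.coord i / Y.coord j, ?_⟩, rfl⟩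
    exact IntermediateField.subset_adjoin _ _ ⟨i, j, rfl⟩
  | algebraMap c => exact IntermediateField.algebraMap_mem _ c
  | add x y _ _ hx hy => exact add_mem hx hy
  | inv x _ hx => exact inv_mem hx
  | mul x y _ _ hx hy => exact mul_mem hx hy

variable {Y}

theorem IsCoordinateFunctions.incl {F : Type*} [Field F] [Algebra F K]
    {y : Fin (n + 1) → Y.functionField F} (hy : Y.IsCoordinateFunctions y) :
    Y.IsCoordinateFunctions (F := K) fun i => Y.incl F (y i) := by
  refine ⟨fun h => hy.1 (funext fun i => ?_), hy.2⟩
  exact (map_eq_zero (Y.incl F)).mp (congrFun h i)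

namespace ModelPoint

variable (P : Y.ModelPoint)

theorem ring_injective : Function.Injective (ModelPoint.ring : Y.ModelPoint → _) := by
  rintro ⟨P, _, _⟩ ⟨P', _, _⟩ rfl
  rfl

theorem ring_ne_top : P.ring ≠ ⊤ := by
  intro h
  refine IsDiscreteValuationRing.not_isField P.ring
    ⟨⟨0, 1, zero_ne_one⟩, mul_comm, fun {a} ha => ?_⟩
  have hinv : (a : Y.functionField K)⁻¹ ∈ P.ring := h.ge (ValuationSubring.mem_top _)
  exact ⟨⟨_, hinv⟩, Subtype.ext (mul_inv_cancel₀ fun h0 => ha (Subtype.ext h0))⟩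

noncomputable instance : Algebra K P.ring :=
  ((algebraMap K (Y.functionField K)).codRestrict P.ring.toSubring P.algebraMap_mem).toAlgebra

instance : IsScalarTower K P.ring (Y.functionField K) :=
  IsScalarTower.of_algebraMap_eq fun _ => rfl

/-- The affine coordinate `Yᵢ / Yⱼ` as a regular function at `P`, in the chart `Yⱼ ≠ 0` chosen
at `P`. -/
noncomputable def affineCoord (i : Fin (n + 1)) : P.ring :=
  ⟨Y.ratio i P.chart, P.exists_chart.choose_spec.2 i⟩

theorem intersectionMultiplicity_pow (b : Fin (n + 1) → K) (q : ℕ) :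
    P.intersectionMultiplicity (fun i => b i ^ q) =
      IsDiscreteValuationRing.addVal P.ring
        (∑ i, algebraMap K P.ring (b i) ^ q * P.affineCoord i) := by
  simp only [← map_pow]
  rfl

variable {P}

theorem hasValue_coe_iff {f : P.ring} {c : K} :
    P.HasValue f c ↔ f - algebraMap K P.ring c ∈ IsLocalRing.maximalIdeal P.ring :=
  P.ring.coe_mem_nonunits_iff (a := f - algebraMap K P.ring c)

theorem HasValue.mem_ring {f : Y.functionField K} {c : K} (h : P.HasValue f c) : f ∈ P.ring := by
  simpa only [sub_add_cancel] using add_mem (P.ring.nonunits_subset h) (P.algebraMap_mem c)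

section CoordinateFunctions

variable {y : Fin (n + 1) → Y.functionField K} (hy : Y.IsCoordinateFunctions y)
include hy

theorem coordinateFunction_eq_mul_affineCoord (i : Fin (n + 1)) :
    y i = y P.chart * P.affineCoord i := by
  have hj : Y.coord P.chart ≠ 0 := P.exists_chart.choose_spec.1
  refine Subtype.ext ?_
  change (y i : Y.ConeField) = (y P.chart : Y.ConeField) * (Y.coord i / Y.coord P.chart)
  rw [← mul_div_assoc, ← hy.2 i P.chart, mul_div_cancel_right₀ _ hj]

theorem coordinateFunction_chart_ne_zero : y P.chart ≠ 0 := by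
  intro h
  refine hy.1 (funext fun i => ?_)
  rw [coordinateFunction_eq_mul_affineCoord (P := P) hy i, h, zero_mul, Pi.zero_apply]

theorem sum_mul_coordinateFunction (w : Fin (n + 1) → Y.functionField K) :
    ∑ i, w i * y i = y P.chart * ∑ i, w i * P.affineCoord i := by
  rw [Finset.mul_sum]
  refine Finset.sum_congr rfl fun i _ => ?_
  rw [coordinateFunction_eq_mul_affineCoord (P := P) hy i, mul_left_comm]

theorem sum_pow_mul_affineCoord_eq_zero {q : ℕ} {v : Fin (n + 1) → P.ring}
    (hrel : ∑ i, (v i : Y.functionField K) ^ q * y i = 0) :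
    ∑ i, v i ^ q * P.affineCoord i = 0 := by
  rw [sum_mul_coordinateFunction (P := P) hy] at hrel
  refine Subtype.ext ?_
  push_cast
  exact (mul_eq_zero.mp hrel).resolve_left (coordinateFunction_chart_ne_zero hy)

variable (p : ℕ) [ExpChar K p] (r : ℕ) {u : Fin (n + 1) → Y.functionField K}
  {b : Fin (n + 1) → K} (hub : ∀ i, P.HasValue (u i) (b i)) (hrel : ∑ i, u i ^ p ^ r * y i = 0)
include hub hrel

theorem le_intersectionMultiplicity :
    (p ^ r : ℕ) ≤ P.intersectionMultiplicity fun i => b i ^ p ^ r := by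
  have := expChar_of_injective_algebraMap (algebraMap K P.ring).injective p
  lift u to Fin (n + 1) → P.ring using fun i => (hub i).mem_ring
  rw [intersectionMultiplicity_pow]
  exact le_addVal_sum_pow_mul p r (fun i => hasValue_coe_iff.mp (hub i))
    (sum_pow_mul_affineCoord_eq_zero hy hrel)

theorem intersectionMultiplicity_eq_iff
    (D : Derivation K (Y.functionField K) (Y.functionField K)) (hD : ∀ f ∈ P.ring, D f ∈ P.ring)
    {ξ : Y.functionField K} (hDξ : D ξ = 1) {c : K} (hξ : P.HasValue ξ c) :
    P.intersectionMultiplicity (fun i => b i ^ p ^ r) = (p ^ r : ℕ) ↔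
      P.ring.valuation (∑ i, D (u i) ^ p ^ r * P.affineCoord i) = 1 := by
  have := expChar_of_injective_algebraMap (algebraMap K P.ring).injective p
  lift u to Fin (n + 1) → P.ring using fun i => (hub i).mem_ring
  lift ξ to P.ring using hξ.mem_ring
  let δ : Derivation K P.ring P.ring := restrictDerivation P.ring D hD
  have hδ : δ (ξ - algebraMap K P.ring c) = 1 := by
    rw [map_sub, δ.map_algebraMap, sub_zero]
    exact Subtype.ext hDξ
  rw [intersectionMultiplicity_pow, addVal_sum_pow_mul_eq_iff p r δ (hasValue_coe_iff.mp hξ) hδ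
    (fun i => hasValue_coe_iff.mp (hub i)) (sum_pow_mul_affineCoord_eq_zero hy hrel),
    ValuationSubring.valuation_eq_one_iff]
  push_cast
  rfl

end CoordinateFunctions

open Filter in
theorem tendsto_ring :
    Tendsto (ModelPoint.ring (Y := Y)) cofinite (cofinitePlaces K (Y.functionField K)) :=
  tendsto_inf.mpr ⟨ring_injective.tendsto_cofinite,
    tendsto_principal.mpr (.of_forall ModelPoint.algebraMap_mem)⟩

end ModelPoint

end ProjVariety

namespace ProjCurve

open Filter ProjVariety

variable {K : Type*} [Field K] {n : ℕ} (Y : ProjCurve K n)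

instance transcendental_functionField : Algebra.Transcendental K (Y.functionField K) :=
  trdeg_ne_zero_iff.mp (Y.trdeg_eq_one.trans_ne one_ne_zero)

variable {Y} [IsAlgClosed K]

theorem eventually_valuation_eq_one_iff (f : Y.functionField K) :
    ∀ᶠ P : Y.ModelPoint in cofinite, P.ring.valuation f = 1 ↔ f ≠ 0 := by
  rcases eq_or_ne f 0 with rfl | hf
  · simp
  · filter_upwards [ModelPoint.tendsto_ring.eventually
      (cofinitePlaces.eventually_valuation_eq_one Y.trdeg_eq_one hf)] with P hP
    exact iff_of_true hP hf

theorem eventually_exists_hasValue (f : Y.functionField K) :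
    ∀ᶠ P : Y.ModelPoint in cofinite, ∃ c, P.HasValue f c := by
  filter_upwards [ModelPoint.tendsto_ring.eventually
    (cofinitePlaces.eventually_mem Y.trdeg_eq_one f)] with P hP
  exact exists_sub_algebraMap_mem_nonunits Y.trdeg_eq_one P.algebraMap_mem P.ring_ne_top hP

theorem eventually_exists_hasValue_ne_zero {ι : Type*} [Finite ι] {u : ι → Y.functionField K}
    (hu : u ≠ 0) :
    ∀ᶠ P : Y.ModelPoint in cofinite, ∃ b : ι → K, b ≠ 0 ∧ ∀ i, P.HasValue (u i) (b i) := by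
  obtain ⟨j, hj⟩ := Function.ne_iff.mp hu
  filter_upwards [eventually_all.mpr fun i => eventually_exists_hasValue (u i),
    eventually_valuation_eq_one_iff (u j)] with P hP hjP
  choose b hb using hP
  refine ⟨b, fun h => ?_, hb⟩
  have hlt : P.ring.valuation (u j) < 1 := by
    simpa only [ModelPoint.HasValue, h, Pi.zero_apply, map_zero, sub_zero] using hb j
  exact hlt.ne (hjP.mpr hj)

variable {y u : Fin (n + 1) → Y.functionField K} (hy : Y.IsCoordinateFunctions y)
include hy

theorem eventually_valuation_sum_mul_affineCoord_eq_one_iff (w : Fin (n + 1) → Y.functionField K) :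
    ∀ᶠ P : Y.ModelPoint in cofinite,
      P.ring.valuation (∑ i, w i * P.affineCoord i) = 1 ↔ ∑ i, w i * y i ≠ 0 := by
  filter_upwards [eventually_all.mpr fun i => eventually_valuation_eq_one_iff (y i),
    eventually_valuation_eq_one_iff (∑ i, w i * y i)] with P hyP hwP
  have hchart := (hyP P.chart).mpr (ModelPoint.coordinateFunction_chart_ne_zero hy)
  rw [← hwP, ModelPoint.sum_mul_coordinateFunction (P := P) hy, map_mul, hchart, one_mul]

theorem eventually_intersectionMultiplicity_eq_iff (p : ℕ) [ExpChar K p] (r : ℕ)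
    (hrel : ∑ i, u i ^ p ^ r * y i = 0) :
    ∀ᶠ P : Y.ModelPoint in cofinite, ∀ b : Fin (n + 1) → K, (∀ i, P.HasValue (u i) (b i)) →
      ∀ (ζ : Y.functionField K) (hζ : IsSeparatingElement K ζ),
        (P.intersectionMultiplicity (fun i => b i ^ p ^ r) = (p ^ r : ℕ) ↔
          ∑ i, hζ.hasseDeriv (u i) ^ p ^ r * y i ≠ 0) := by
  -- The condition on `ζ` does not depend on `ζ`, so one fixed separating element `ξ` suffices.
  obtain ⟨ξ, hξ⟩ := exists_isSeparatingElement (F := K) Y.trdeg_eq_one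
  filter_upwards [ModelPoint.tendsto_ring.eventually
      (cofinitePlaces.eventually_derivation_mem Y.trdeg_eq_one hξ.hasseDeriv),
    eventually_exists_hasValue ξ,
    eventually_valuation_sum_mul_affineCoord_eq_one_iff hy fun i => hξ.hasseDeriv (u i) ^ p ^ r]
    with P hDP ⟨c, hc⟩ hwP b hub ζ hζ
  rw [ModelPoint.intersectionMultiplicity_eq_iff hy p r hub hrel hξ.hasseDeriv hDP
    hξ.hasseDeriv_self hc, hwP]
  exact (hξ.sum_hasseDeriv_pow_mul_eq_zero_iff hζ u y (p ^ r)).not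

end ProjCurve

theorem proposition3p1_general {k K : Type*} [Field k] [Field K] [Algebra k K] [IsAlgClosed K]
    (p : ℕ) [ExpChar k p] {n : ℕ} (Y : ProjCurve K n) (y : Fin (n + 1) → Y.functionField k)
    (hy : Y.IsCoordinateFunctions y) (r : ℕ) (u : Fin (n + 1) → Y.functionField k) (hu : u ≠ 0)
    (hrel : ∑ i, u i ^ p ^ r * y i = 0) :
    ∀ᶠ P : Y.ModelPoint in Filter.cofinite,
      ∃ b : Fin (n + 1) → K, b ≠ 0 ∧ (∀ i, P.HasValue (Y.incl k (u i)) (b i)) ∧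
        ((p ^ r : ℕ) : ℕ∞) ≤ P.intersectionMultiplicity (fun i => b i ^ p ^ r) ∧
        ∀ (ζ : Y.functionField k) (hζ : IsSeparatingElement k ζ),
          (P.intersectionMultiplicity (fun i => b i ^ p ^ r) = ((p ^ r : ℕ) : ℕ∞) ↔
            ∑ i, hζ.hasseDeriv (u i) ^ p ^ r * y i ≠ 0) := by
  have := expChar_of_injective_algebraMap (algebraMap k K).injective p
  let σ := Y.incl k
  have hyσ : Y.IsCoordinateFunctions fun i => σ (y i) := hy.incl
  have huσ : (fun i => σ (u i)) ≠ 0 := fun h =>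
    hu (funext fun i => (map_eq_zero σ).mp (congrFun h i))
  have hrelσ : ∑ i, σ (u i) ^ p ^ r * σ (y i) = 0 := by
    simpa only [map_sum, map_mul, map_pow, map_zero] using congrArg σ hrel
  filter_upwards [ProjCurve.eventually_exists_hasValue_ne_zero huσ,
    ProjCurve.eventually_intersectionMultiplicity_eq_iff hyσ p r hrelσ] with P ⟨b, hb, hub⟩ hP
  refine ⟨b, hb, hub, ProjVariety.ModelPoint.le_intersectionMultiplicity hyσ p r hub hrelσ,
    fun ζ hζ => ?_⟩
  have hσζ : IsSeparatingElement K (σ ζ) := hζ.map σ (Y.adjoin_range_incl k)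
  rw [hP b hub (σ ζ) hσζ, ← map_ne_zero σ]
  simp only [map_sum, map_mul, map_pow, hζ.hasseDeriv_map σ hσζ]

theorem proposition3p1 {k K : Type*} [Field k] [PerfectField k] [Field K] [Algebra k K]
    [IsAlgClosure k K] (p : ℕ) [Fact p.Prime] [CharP k p] {n : ℕ} (hpn : n < p)
    (Y : ProjCurve K n) (hYk : Y.IsDefinedOver k) (hY : Y.IsNondegenerate)
    (y : Fin (n + 1) → Y.functionField k) (hy : Y.IsCoordinateFunctions y)
    (r : ℕ) (hr : 0 < r) (u : Fin (n + 1) → Y.functionField k) (hu : u ≠ 0)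
    (hrel : ∑ i, u i ^ p ^ r * y i = 0) :
    ∀ᶠ P : Y.ModelPoint in Filter.cofinite,
      ∃ b : Fin (n + 1) → K, b ≠ 0 ∧ (∀ i, P.HasValue (Y.incl k (u i)) (b i)) ∧
        ((p ^ r : ℕ) : ℕ∞) ≤ P.intersectionMultiplicity (fun i => b i ^ p ^ r) ∧
        ∀ (ζ : Y.functionField k) (hζ : IsSeparatingElement k ζ),
          (P.intersectionMultiplicity (fun i => b i ^ p ^ r) = ((p ^ r : ℕ) : ℕ∞) ↔
            ∑ i, hζ.hasseDeriv (u i) ^ p ^ r * y i ≠ 0) := by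
  have : IsAlgClosed K := IsAlgClosure.isAlgClosed k
  exact proposition3p1_general p Y y hy r u hu hrel
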